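/- **Definitions.** Simple types are built from one atom $o$; every type has the form $A_1\to\cdots\to A_n\to o$. The order is $\mathrm{ord}(o)=0$, $\mathrm{ord}(A\to B)=\max(\mathrm{ord}(A)+1,\mathrm{ord}(B))$. The type $A_1\to\cdots\to A_n\to o$ is *homogeneous* if $\mathrm{ord}(A_1)\ge\cdots\ge\mathrm{ord}(A_n)$ and every $A_i$ is homogeneous. A *higher-order recursion scheme* $G=\langle\Sigma,\mathcal N,\mathcal R,S\rangle$ consists of a ranked alphabet $\Sigma$ of terminals (each of a type $o\to\cdots\to o\to o$), a finite set $\mathcal N$ of simply typed non-terminals, a start symbol $S\in\mathcal N$ of type $o$, and, for each $F\in\mathcal N$ of type $A_1\to\cdots\to A_m\to o$, exactly one rule $F\,z_1\cdots z_m\to e_F$, where the parameter $z_i$ is a variable of type $A_i$ and $e_F$ is an applicative term of type $o$ built from $\Sigma\cup\mathcal N\cup\{z_1,\dots,z_m\}$. A rewriting step replaces, anywhere in an applicative term over $\Sigma\cup\mathcal N$, a subterm $F\,t_1\cdots t_m$ of type $o$ by $e_F[t_1/z_1,\dots,t_m/z_m]$. The scheme has *no dead rule* if for every rule there is a derivation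 from $S$ that uses it. It is *homogeneous* if the types of all non-terminals are homogeneous. It is *safe* (in the sense of Knapik et al.) if it is homogeneous and no right-hand side $e_F$ has a subterm that occurs in operand position (as the second component of an application) and contains a parameter of order strictly less than the order of that subterm. Put $\Lambda(F)=\lambda z_1\cdots z_m.\,e_F$, a simply typed $\lambda$-term in which terminals and non-terminals are symbols that are never bound. The *unfolding* of a $\lambda$-term $M$ over $\Sigma\cup\mathcal N$ is obtained by replacing every occurrence of every non-terminal $F$ by $\Lambda(F)$. The *computation tree* $\tau(M)$ is the abstract syntax tree of the $\eta$-long normal form of $M$: $$\tau(\lambda\overline x.\,z\,s_1\cdots s_m)=\lambda\overline x\,\langle z\langle\tau(s_1),\dots,\tau(s_m)\rangle\rangle\quad(z\text{ a variable, terminal or non-terminal},\ m\ge 0),$$ $$\tau(\lambda\overline x.\,(\lambda y.t)\,s_1\cdots s_m)=\lambda\overline x\,\langle @\langle\tau(\lambda y.t),\tau(s_1),\dots,\tau(s_m)\rangle\rangle\quad(m\ge 1).$$ A node $\lambda x_1\cdots x_n$ with $n>0$ has order $1+\max_i\mathrm{ord}(x_i)$, and a dummy node $\lambda$ ($n=0$)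 has order $0$. A tree $\tau(M)$, where $M$ has no free symbols besides terminals and non-terminals, is *incrementally-bound* if every variable node $x$ is bound by the first $\lambda$-node, on the path from $x$ to the root, whose order is strictly greater than $\mathrm{ord}(x)$; nodes labelled by terminals or non-terminals are not variable nodes. The scheme $G$ is *incrementally-bound* if for every $k\ge 0$ the computation tree of the $k$-fold unfolding of $\Lambda(S)$ is incrementally-bound. **Proposition (Binder characterization for HORS).** A higher-order recursion scheme with no dead rule is safe if and only if it is homogeneous and incrementally-bound. -/

import Mathlib

universe u v

namespace RecScheme

/-! ### Simple types over one atom -/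

inductive Ty : Type
  | o : Ty
  | arr : Ty → Ty → Ty

/-- `ord o = 0`, `ord (A → B) = max (ord A + 1) (ord B)`. -/
def Ty.ord : Ty → ℕ
  | .o => 0
  | .arr A B => max (A.ord + 1) B.ord

/-- The argument types `A₁, …, Aₙ` of `A₁ → ⋯ → Aₙ → o`. -/
def Ty.args : Ty → List Ty
  | .o => []
  | .arr A B => A :: B.args

/-- `A₁ → ⋯ → Aₙ → o` is homogeneous when `ord A₁ ≥ ⋯ ≥ ord Aₙ` and every `Aᵢ` is homogeneous. -/
inductive Ty.Homogeneous : Ty → Prop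
  | mk (A : Ty) (sorted : A.args.Pairwise (fun X Y => Y.ord ≤ X.ord))
      (args : ∀ X ∈ A.args, Ty.Homogeneous X) : Ty.Homogeneous A

/-- `o → ⋯ → o → o` with `n` arguments. -/
def Ty.ground : ℕ → Ty
  | 0 => .o
  | n + 1 => .arr .o (Ty.ground n)

/-! ### Variables (typed de Bruijn indices) -/

/-- `Var Γ A`: a variable of type `A` in the context `Γ`; the most recently bound variable is
the head of `Γ`. -/
inductive Var : List Ty → Ty → Type
  | zero {Γ : List Ty} {A : Ty} : Var (A :: Γ) A
  | succ {Γ : List Ty} {A B : Ty} : Var Γ A → Var (B :: Γ) A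

/-- The context `Γ` extended by variables `x₁ : A₁, …, xₙ : Aₙ`, where `A = A₁ → ⋯ → Aₙ → o`. -/
def ctx : Ty → List Ty → List Ty
  | .o, Γ => Γ
  | .arr A B, Γ => ctx B (A :: Γ)

def Var.weaken : (A : Ty) → {Γ : List Ty} → {B : Ty} → Var Γ B → Var (ctx A Γ) B
  | .o, _, _, x => x
  | .arr _ C, _, _, x => Var.weaken C (Var.succ x)

/-- Type-preserving renamings. -/
def Ren (Γ Δ : List Ty) : Type := ∀ A : Ty, Var Γ A → Var Δ A

def Ren.lift {Γ Δ : List Ty} (ρ : Ren Γ Δ) (A : Ty) : Ren (A :: Γ) (A :: Δ)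
  | _, .zero => .zero
  | _, .succ x => .succ (ρ _ x)

/-! ### Applicative terms and recursion schemes -/

/-- Terminals with their arities and non-terminals with their types. -/
structure Sig where
  T : Type u
  N : Type v
  arity : T → ℕ
  ty : N → Ty

/-- Applicative terms over terminals, non-terminals and the variables of `Γ`. -/
inductive App (Sg : Sig.{u, v}) (Γ : List Ty) : Ty → Type (max u v)
  | var {A : Ty} (x : Var Γ A) : App Sg Γ A
  | term (f : Sg.T) : App Sg Γ (Ty.ground (Sg.arity f))
  | nt (F : Sg.N) : App Sg Γ (Sg.ty F)
  | app {A B : Ty} (s : App Sg Γ (.arr A B)) (t : App Sg Γ A) : App Sg Γ B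

/-- Higher-order recursion schemes. The unique rule of `F : A₁ → ⋯ → Aₘ → o` is
`F z₁ … zₘ → rhs F`; its parameters `z₁ : A₁, …, zₘ : Aₘ` are the variables of `ctx (ty F) []`. -/
structure HORS extends Sig.{u, v} where
  finite_nt : Finite N
  start : N
  start_ty : ty start = .o
  rhs : (F : N) → App toSig (ctx (ty F) []) .o

/-! ### Derivations and dead rules -/

/-- Sequences of arguments `t₁ : A₁, …, tₙ : Aₙ` for a head of type `A₁ → ⋯ → Aₙ → o`. -/
inductive Args (Sg : Sig.{u, v}) (Γ : List Ty) : Ty → Type (max u v)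
  | nil : Args Sg Γ .o
  | cons {A B : Ty} (t : App Sg Γ A) (ts : Args Sg Γ B) : Args Sg Γ (.arr A B)

/-- `s t₁ … tₙ`. -/
def App.apps {Sg : Sig.{u, v}} {Γ : List Ty} : {A : Ty} → App Sg Γ A → Args Sg Γ A → App Sg Γ .o
  | _, s, .nil => s
  | _, s, .cons t ts => App.apps (.app s t) ts

def Sub (Sg : Sig.{u, v}) (Γ Δ : List Ty) : Type (max u v) := ∀ A : Ty, Var Γ A → App Sg Δ A

def Sub.cons {Sg : Sig.{u, v}} {Γ Δ : List Ty} {A : Ty} (t : App Sg Δ A) (σ : Sub Sg Γ Δ) :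
    Sub Sg (A :: Γ) Δ
  | _, .zero => t
  | _, .succ x => σ _ x

/-- Extend `σ` by `xᵢ ↦ tᵢ`. -/
def Args.sub {Sg : Sig.{u, v}} {Δ : List Ty} :
    {A : Ty} → Args Sg Δ A → {Γ : List Ty} → Sub Sg Γ Δ → Sub Sg (ctx A Γ) Δ
  | _, .nil, _, σ => σ
  | _, .cons t ts, _, σ => Args.sub ts (Sub.cons t σ)

def App.subst {Sg : Sig.{u, v}} {Γ Δ : List Ty} (σ : Sub Sg Γ Δ) :
    {A : Ty} → App Sg Γ A → App Sg Δ A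
  | _, .var x => σ _ x
  | _, .term f => .term f
  | _, .nt F => .nt F
  | _, .app s t => .app (s.subst σ) (t.subst σ)

/-- One rewriting step, at any position of the term, with the rule of `F`:
`F t₁ … tₘ → (rhs F)[t₁/z₁, …, tₘ/zₘ]`. -/
inductive HORS.StepBy (G : HORS.{u, v}) (F : G.N) :
    {A : Ty} → App G.toSig [] A → App G.toSig [] A → Prop
  | rule (ts : Args G.toSig [] (G.ty F)) :
      HORS.StepBy G F ((App.nt F).apps ts) ((G.rhs F).subst (ts.sub (fun _ x => .var x)))
  | left {A B : Ty} {s s' : App G.toSig [] (.arr A B)} (t : App G.toSig [] A) :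
      HORS.StepBy G F s s' → HORS.StepBy G F (.app s t) (.app s' t)
  | right {A B : Ty} (s : App G.toSig [] (.arr A B)) {t t' : App G.toSig [] A} :
      HORS.StepBy G F t t' → HORS.StepBy G F (.app s t) (.app s t')

/-- For every rule there is a derivation from the start symbol that uses it. -/
def HORS.NoDeadRule (G : HORS.{u, v}) : Prop :=
  ∀ F : G.N, ∃ t t' : App G.toSig [] (G.ty G.start),
    Relation.ReflTransGen (fun s s' => ∃ F' : G.N, G.StepBy F' s s') (.nt G.start) t ∧
      G.StepBy F t t'

/-! ### Safety -/

/-- `App.Operand t e`: the subterm `t` occurs in operand position in `e`. -/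
inductive App.Operand {Sg : Sig.{u, v}} {Γ : List Ty} {C : Ty} (t : App Sg Γ C) :
    {A : Ty} → App Sg Γ A → Prop
  | here {B : Ty} (s : App Sg Γ (.arr C B)) : App.Operand t (.app s t)
  | left {A B : Ty} {s : App Sg Γ (.arr A B)} (r : App Sg Γ A) :
      App.Operand t s → App.Operand t (.app s r)
  | right {A B : Ty} (s : App Sg Γ (.arr A B)) {r : App Sg Γ A} :
      App.Operand t r → App.Operand t (.app s r)

/-- `App.Contains x e`: the variable `x` occurs in `e`. -/
inductive App.Contains {Sg : Sig.{u, v}} {Γ : List Ty} {C : Ty} (x : Var Γ C) :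
    {A : Ty} → App Sg Γ A → Prop
  | here : App.Contains x (.var x)
  | left {A B : Ty} {s : App Sg Γ (.arr A B)} (r : App Sg Γ A) :
      App.Contains x s → App.Contains x (.app s r)
  | right {A B : Ty} (s : App Sg Γ (.arr A B)) {r : App Sg Γ A} :
      App.Contains x r → App.Contains x (.app s r)

/-- All non-terminals have homogeneous types. -/
def HORS.Homogeneous (G : HORS.{u, v}) : Prop := ∀ F : G.N, (G.ty F).Homogeneous

/-- Some right-hand side has a subterm in operand position that contains a parameter of order
strictly less than its own order. -/
def HORS.HasUnsafeRule (G : HORS.{u, v}) : Prop :=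
  ∃ (F : G.N) (C : Ty) (t : App G.toSig (ctx (G.ty F) []) C) (D : Ty)
    (z : Var (ctx (G.ty F) []) D),
    t.Operand (G.rhs F) ∧ App.Contains z t ∧ D.ord < C.ord

def HORS.Safe (G : HORS.{u, v}) : Prop := G.Homogeneous ∧ ¬ G.HasUnsafeRule

/-! ### Simply-typed lambda terms and unfolding -/

/-- Simply-typed lambda terms with terminals and non-terminals as free symbols that are never
bound. -/
inductive Tm (Sg : Sig.{u, v}) : List Ty → Ty → Type (max u v)
  | var {Γ : List Ty} {A : Ty} (x : Var Γ A) : Tm Sg Γ A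
  | term {Γ : List Ty} (f : Sg.T) : Tm Sg Γ (Ty.ground (Sg.arity f))
  | nt {Γ : List Ty} (F : Sg.N) : Tm Sg Γ (Sg.ty F)
  | app {Γ : List Ty} {A B : Ty} (s : Tm Sg Γ (.arr A B)) (t : Tm Sg Γ A) : Tm Sg Γ B
  | lam {Γ : List Ty} {A B : Ty} (t : Tm Sg (A :: Γ) B) : Tm Sg Γ (.arr A B)

def App.toTm {Sg : Sig.{u, v}} {Γ : List Ty} : {A : Ty} → App Sg Γ A → Tm Sg Γ A
  | _, .var x => .var x
  | _, .term f => .term f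
  | _, .nt F => .nt F
  | _, .app s t => .app s.toTm t.toTm

def Tm.rename {Sg : Sig.{u, v}} : {Γ : List Ty} → {A : Ty} → Tm Sg Γ A →
    {Δ : List Ty} → Ren Γ Δ → Tm Sg Δ A
  | _, _, .var x, _, ρ => .var (ρ _ x)
  | _, _, .term f, _, _ => .term f
  | _, _, .nt F, _, _ => .nt F
  | _, _, .app s t, _, ρ => .app (s.rename ρ) (t.rename ρ)
  | _, _, .lam t, _, ρ => .lam (t.rename (ρ.lift _))

/-- `λ x₁ … xₙ. t` of type `A = A₁ → ⋯ → Aₙ → o`. -/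
def Tm.lams {Sg : Sig.{u, v}} : (A : Ty) → {Γ : List Ty} → Tm Sg (ctx A Γ) .o → Tm Sg Γ A
  | .o, _, t => t
  | .arr _ B, _, t => .lam (Tm.lams B t)

/-- The term `Λ(F) = λ z₁ … zₘ. rhs F`. -/
def HORS.Lam (G : HORS.{u, v}) (F : G.N) : Tm G.toSig [] (G.ty F) :=
  Tm.lams (G.ty F) (G.rhs F).toTm

/-- Replace every non-terminal `F` by `Λ(F)`, which has no free variables. -/
def HORS.unfold (G : HORS.{u, v}) : {Γ : List Ty} → {A : Ty} → Tm G.toSig Γ A → Tm G.toSig Γ A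
  | _, _, .var x => .var x
  | _, _, .term f => .term f
  | _, _, .nt F => (G.Lam F).rename (fun _ x => nomatch x)
  | _, _, .app s t => .app (G.unfold s) (G.unfold t)
  | _, _, .lam t => .lam (G.unfold t)

/-! ### Computation trees -/

mutual

/-- A computation tree of type `A = A₁ → ⋯ → Aₙ → o`: a lambda node `λ x₁ … xₙ`, `xᵢ : Aᵢ`
(a dummy lambda when `A = o`), with its only child. Computation trees are the abstract syntax
trees of the terms in eta-long normal form. -/
inductive CTree (Sg : Sig.{u, v}) : List Ty → Ty → Type (max u v)
  | lam {Γ : List Ty} (A : Ty) (b : CBody Sg (ctx A Γ)) : CTree Sg Γ A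

/-- A subtree whose root is a variable, a terminal, a non-terminal or an `@`. The first child of
`@` is the operator; the remaining ones, of which there is at least one, are the operands. -/
inductive CBody (Sg : Sig.{u, v}) : List Ty → Type (max u v)
  | var {Γ : List Ty} {A : Ty} (x : Var Γ A) (ts : CArgs Sg Γ A) : CBody Sg Γ
  | term {Γ : List Ty} (f : Sg.T) (ts : CArgs Sg Γ (Ty.ground (Sg.arity f))) : CBody Sg Γ
  | nt {Γ : List Ty} (F : Sg.N) (ts : CArgs Sg Γ (Sg.ty F)) : CBody Sg Γ
  | at {Γ : List Ty} {A B : Ty} (s : CTree Sg Γ (.arr A B)) (ts : CArgs Sg Γ (.arr A B)) :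
      CBody Sg Γ

/-- The operand children `t₁ : A₁, …, tₙ : Aₙ` of a head of type `A₁ → ⋯ → Aₙ → o`. -/
inductive CArgs (Sg : Sig.{u, v}) : List Ty → Ty → Type (max u v)
  | nil {Γ : List Ty} : CArgs Sg Γ .o
  | cons {Γ : List Ty} {A B : Ty} (t : CTree Sg Γ A) (ts : CArgs Sg Γ B) : CArgs Sg Γ (.arr A B)

end

/-- The eta-long forms of the variables `x₁ : A₁, …, xₙ : Aₙ` that extend `Γ` to `ctx A Γ`. -/
def etaVars (Sg : Sig.{u, v}) : (A : Ty) → (Γ : List Ty) → CArgs Sg (ctx A Γ) A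
  | .o, _ => .nil
  | .arr A B, Γ =>
    .cons (.lam A (.var (Var.weaken A (Var.weaken B (Var.zero (Γ := Γ)))) (etaVars Sg A _)))
      (etaVars Sg B (A :: Γ))

mutual

/-- The child of the root lambda node of the computation tree of `t` (renamed along `ρ`): leading
abstractions are absorbed into that lambda node, and what is below them is eta-expanded. -/
def Tm.under {Sg : Sig.{u, v}} : {Γ : List Ty} → {A : Ty} → Tm Sg Γ A →
    {Δ : List Ty} → Ren Γ Δ → CBody Sg (ctx A Δ)
  | _, _, .var (A := A) x, Δ, ρ => .var (Var.weaken A (ρ _ x)) (etaVars Sg A Δ)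
  | _, _, .term f, Δ, _ => .term f (etaVars Sg _ Δ)
  | _, _, .nt F, Δ, _ => .nt F (etaVars Sg _ Δ)
  | _, _, .app (B := B) s t, Δ, ρ =>
    s.spine (fun _ x => Var.weaken B (ρ _ x))
      (.cons (.lam _ (t.under (fun _ x => Var.weaken B (ρ _ x)))) (etaVars Sg B Δ))
  | _, _, .lam t, _, ρ => t.under (ρ.lift _)

/-- The tree of the ground-type term `t t₁ … tₙ`, given the computation trees of the `tᵢ`. -/
def Tm.spine {Sg : Sig.{u, v}} : {Γ : List Ty} → {A : Ty} → Tm Sg Γ A →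
    {Δ : List Ty} → Ren Γ Δ → CArgs Sg Δ A → CBody Sg Δ
  | _, _, .var x, _, ρ, ts => .var (ρ _ x) ts
  | _, _, .term f, _, _, ts => .term f ts
  | _, _, .nt F, _, _, ts => .nt F ts
  | _, _, .app s t, _, ρ, ts => s.spine ρ (.cons (.lam _ (t.under ρ)) ts)
  | _, _, .lam (A := A) (B := B) t, _, ρ, ts =>
    .at (.lam (.arr A B) (t.under (ρ.lift A))) ts

end

/-- The computation tree `τ(M)`. -/
def Tm.tree {Sg : Sig.{u, v}} {Γ : List Ty} {A : Ty} (M : Tm Sg Γ A) : CTree Sg Γ A :=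
  .lam A (M.under (fun _ x => x))

/-! ### Incremental binding -/

/-- The order of a lambda node `λ x₁ … xₙ`, `xᵢ : Aᵢ`: `1 + max ord Aᵢ` if `n > 0`, and `0` for a
dummy lambda. -/
def lamOrder (As : List Ty) : ℕ := (As.map (fun A => 1 + A.ord)).foldr max 0

/-- Extend `b` to `ctx A Γ` by giving the value `0` to the new variables `x₁, …, xₙ`. -/
def bindNew : (A : Ty) → {Γ : List Ty} → (∀ B : Ty, Var Γ B → ℕ) → ∀ B : Ty, Var (ctx A Γ) B → ℕ
  | .o, _, b => b
  | .arr _ C, _, b => bindNew C (fun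
    | _, .zero => 0
    | _, .succ x => b _ x)

mutual

/-- Below, `path` lists the orders of the lambda nodes on the path from the current node to the
root, nearest first, and `b x` is the position in that list of the binder of `x`. Each variable
node has to be bound by the first lambda node on its path whose order is strictly greater than
the order of the variable. -/
def CTree.IncBound {Sg : Sig.{u, v}} : {Γ : List Ty} → {A : Ty} → CTree Sg Γ A →
    (path : List ℕ) → (b : ∀ B : Ty, Var Γ B → ℕ) → Prop
  | _, _, .lam A t, path, b =>
    t.IncBound (lamOrder A.args :: path) (bindNew A (fun _ x => b _ x + 1))

def CBody.IncBound {Sg : Sig.{u, v}} : {Γ : List Ty} → CBody Sg Γ →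
    (path : List ℕ) → (b : ∀ B : Ty, Var Γ B → ℕ) → Prop
  | _, .var (A := A) x ts, path, b =>
    path.findIdx (fun k => decide (A.ord < k)) = b A x ∧ ts.IncBound path b
  | _, .term _ ts, path, b => ts.IncBound path b
  | _, .nt _ ts, path, b => ts.IncBound path b
  | _, .at s ts, path, b => s.IncBound path b ∧ ts.IncBound path b

def CArgs.IncBound {Sg : Sig.{u, v}} : {Γ : List Ty} → {A : Ty} → CArgs Sg Γ A →
    (path : List ℕ) → (b : ∀ B : Ty, Var Γ B → ℕ) → Prop
  | _, _, .nil, _, _ => True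
  | _, _, .cons t ts, path, b => t.IncBound path b ∧ ts.IncBound path b

end

/-- Incremental binding of a computation tree without free variables. -/
def CTree.IncrementallyBound {Sg : Sig.{u, v}} {A : Ty} (t : CTree Sg [] A) : Prop :=
  t.IncBound [] (fun _ x => nomatch x)

/-- The computation tree of every iterated unfolding of `Λ(S)` is incrementally-bound. -/
def HORS.IncrementallyBound (G : HORS.{u, v}) : Prop :=
  ∀ k : ℕ, ((G.unfold)^[k] (G.Lam G.start)).tree.IncrementallyBound

end RecScheme

namespace RecScheme

/-! ### Orders of lambda nodes -/

-- In the computation tree of `λ z₁ … zₘ. e`, the lambda nodes strictly between an occurrence of a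
-- parameter and its binder are the roots of the operands of `e` that contain it. Since trees are
-- eta-long, the root of an operand of type `A` has order `A.ord`, and the binder has order larger
-- than that of the parameter. So the occurrence is bound incrementally iff no operand around it has
-- larger order, which is the safety condition at that occurrence.
--
-- Nothing else in an unfolding matters: variables created by eta-expansion are always bound
-- incrementally, and an unfolded non-terminal is closed, so its own condition does not depend on
-- where it stands. Hence the unfoldings of `Λ(S)` are incrementally-bound iff operand nesting is
-- respected by all right-hand sides reached from `S` through non-terminals (`HORS.incBound_of_nt`,
-- `HORS.incrementallyBound_iff`). Without dead rules, these are all right-hand sides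
-- (`HORS.NoDeadRule.forall_nt`).

theorem Ty.lamOrder_args (A : Ty) : lamOrder A.args = A.ord := by
  induction A with
  | o => rfl
  | arr A B _ ihB =>
    have h : lamOrder (Ty.arr A B).args = max (1 + A.ord) (lamOrder B.args) := rfl
    rw [h, ihB, Nat.add_comm]
    rfl

/-! ### Renamings -/

def Ren.lifts : (A : Ty) → {Γ Δ : List Ty} → Ren Γ Δ → Ren (ctx A Γ) (ctx A Δ)
  | .o, _, _, ρ => ρ
  | .arr A B, _, _, ρ => Ren.lifts B (ρ.lift A)

theorem Ren.lift_comp {Γ Δ Θ : List Ty} (ρ : Ren Γ Δ) (ρ' : Ren Δ Θ) (A : Ty) :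
    (fun B x => ρ'.lift A B (ρ.lift A B x) : Ren (A :: Γ) (A :: Θ)) =
      Ren.lift (fun B x => ρ' B (ρ B x)) A := by
  funext B x
  cases x <;> rfl

theorem Ren.eq_of_nil {Δ : List Ty} (ρ ρ' : Ren [] Δ) : ρ = ρ' := by
  funext B x
  nomatch x

theorem Tm.rename_rename {Sg : Sig.{u, v}} {Γ : List Ty} {A : Ty} (M : Tm Sg Γ A) :
    ∀ {Δ Θ : List Ty} (ρ : Ren Γ Δ) (ρ' : Ren Δ Θ),
      (M.rename ρ).rename ρ' = M.rename (fun B x => ρ' B (ρ B x)) := by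
  induction M with
  | var x => intros; rfl
  | term f => intros; rfl
  | nt F => intros; rfl
  | app s t ihs iht => intros; simp only [Tm.rename, ihs, iht]
  | lam t ih => intros; simp only [Tm.rename, ih, Ren.lift_comp]

/-- Unfolding inserts `Λ(F)` along a renaming out of the empty context, while the tree functions
carry a renaming of their own; this fuses the two. -/
theorem Tm.under_spine_rename {Sg : Sig.{u, v}} {Γ : List Ty} {A : Ty} (M : Tm Sg Γ A) :
    (∀ {Δ Θ : List Ty} (ρ : Ren Γ Δ) (ρ' : Ren Δ Θ),
      (M.rename ρ).under ρ' = M.under (fun B x => ρ' B (ρ B x))) ∧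
    (∀ {Δ Θ : List Ty} (ρ : Ren Γ Δ) (ρ' : Ren Δ Θ) (ts : CArgs Sg Θ A),
      (M.rename ρ).spine ρ' ts = M.spine (fun B x => ρ' B (ρ B x)) ts) := by
  induction M with
  | var x => exact ⟨fun _ _ => rfl, fun _ _ _ => rfl⟩
  | term f => exact ⟨fun _ _ => rfl, fun _ _ _ => rfl⟩
  | nt F => exact ⟨fun _ _ => rfl, fun _ _ _ => rfl⟩
  | app s t ihs iht =>
    refine ⟨fun {Δ Θ} ρ ρ' => ?_, fun {Δ Θ} ρ ρ' ts => ?_⟩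
    · exact (ihs.2 _ _ _).trans
        (congrArg (fun u => s.spine _ (.cons (.lam _ u) (etaVars Sg _ Θ))) (iht.1 _ _))
    · exact (ihs.2 _ _ _).trans
        (congrArg (fun u => s.spine _ (.cons (.lam _ u) ts)) (iht.1 _ _))
  | lam t ih =>
    have h {Δ Θ : List Ty} (ρ : Ren _ Δ) (ρ' : Ren Δ Θ) :=
      (ih.1 (ρ.lift _) (ρ'.lift _)).trans (congrArg t.under (Ren.lift_comp ρ ρ' _))
    exact ⟨fun ρ ρ' => h ρ ρ', fun ρ ρ' ts => congrArg (fun u => CBody.at (.lam _ u) ts) (h ρ ρ')⟩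

theorem Tm.under_lams {Sg : Sig.{u, v}} (A : Ty) :
    ∀ {Γ Δ : List Ty} (t : Tm Sg (ctx A Γ) .o) (ρ : Ren Γ Δ),
      (Tm.lams A t).under ρ = t.under (ρ.lifts A) := by
  induction A with
  | o => intros; rfl
  | arr A B _ ihB => intro Γ Δ t ρ; exact ihB t (ρ.lift A)

/-! ### Iterated unfolding -/

section Unfold

variable (G : HORS.{u, v})

theorem HORS.unfold_rename {Γ : List Ty} {A : Ty} (M : Tm G.toSig Γ A) :
    ∀ {Δ : List Ty} (ρ : Ren Γ Δ), G.unfold (M.rename ρ) = (G.unfold M).rename ρ := by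
  induction M with
  | var x => intros; rfl
  | term f => intros; rfl
  | nt F =>
    intro Δ ρ
    exact (congrArg (G.Lam F).rename (Ren.eq_of_nil _ _)).trans
      (Tm.rename_rename (G.Lam F) (fun _ x => nomatch x) ρ).symm
  | app s t ihs iht => intros; simp only [Tm.rename, HORS.unfold, ihs, iht]
  | lam t ih => intros; simp only [Tm.rename, HORS.unfold, ih]

theorem HORS.unfold_lams (A : Ty) :
    ∀ {Γ : List Ty} (t : Tm G.toSig (ctx A Γ) .o),
      G.unfold (Tm.lams A t) = Tm.lams A (G.unfold t) := by
  induction A with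
  | o => intros; rfl
  | arr A B _ ihB => intro Γ t; exact congrArg Tm.lam (ihB t)

theorem HORS.iterate_unfold_rename (k : ℕ) {Γ Δ : List Ty} {A : Ty} (M : Tm G.toSig Γ A)
    (ρ : Ren Γ Δ) : (G.unfold)^[k] (M.rename ρ) = ((G.unfold)^[k] M).rename ρ := by
  induction k generalizing M with
  | zero => rfl
  | succ k ih => rw [Function.iterate_succ_apply, HORS.unfold_rename, ih]; rfl

theorem HORS.iterate_unfold_lams (k : ℕ) (A : Ty) {Γ : List Ty} (t : Tm G.toSig (ctx A Γ) .o) :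
    (G.unfold)^[k] (Tm.lams A t) = Tm.lams A ((G.unfold)^[k] t) := by
  induction k generalizing t with
  | zero => rfl
  | succ k ih => rw [Function.iterate_succ_apply, HORS.unfold_lams, ih]; rfl

theorem HORS.iterate_unfold_var (k : ℕ) {Γ : List Ty} {A : Ty} (x : Var Γ A) :
    (G.unfold)^[k] (Tm.var x) = Tm.var x :=
  Function.iterate_fixed rfl k

theorem HORS.iterate_unfold_term (k : ℕ) {Γ : List Ty} (f : G.T) :
    (G.unfold)^[k] (Tm.term f : Tm G.toSig Γ _) = Tm.term f :=
  Function.iterate_fixed rfl k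

theorem HORS.iterate_unfold_app (k : ℕ) {Γ : List Ty} {A B : Ty} (s : Tm G.toSig Γ (.arr A B))
    (t : Tm G.toSig Γ A) :
    (G.unfold)^[k] (Tm.app s t) = Tm.app ((G.unfold)^[k] s) ((G.unfold)^[k] t) := by
  induction k generalizing s t with
  | zero => rfl
  | succ k ih => rw [Function.iterate_succ_apply, HORS.unfold, ih]; rfl

/-- One unfolding is spent on turning `F` into `Λ(F)`; the other `k` act on its body. -/
theorem HORS.iterate_unfold_nt (k : ℕ) {Γ : List Ty} (F : G.N) :
    (G.unfold)^[k + 1] (Tm.nt F : Tm G.toSig Γ _) =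
      (Tm.lams (G.ty F) ((G.unfold)^[k] (G.rhs F).toTm)).rename (fun _ x => nomatch x) := by
  rw [Function.iterate_succ_apply, HORS.unfold]
  exact (G.iterate_unfold_rename k _ _).trans
    (congrArg (fun t => Tm.rename t _) (G.iterate_unfold_lams k _ _))

end Unfold

/-! ### Binder positions -/

theorem bindNew_weaken (A : Ty) : ∀ {Γ : List Ty} (b : ∀ B : Ty, Var Γ B → ℕ) {B : Ty}
    (x : Var Γ B), bindNew A b B (x.weaken A) = b B x := by
  induction A with
  | o => intros; rfl
  | arr A C _ ihC => intro Γ b B x; exact ihC _ _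

theorem bindNew_lifts (A : Ty) : ∀ {Γ Δ : List Ty} (ρ : Ren Γ Δ) (b : ∀ B : Ty, Var Δ B → ℕ),
    (∀ B (x : Var Γ B), b B (ρ B x) = 0) →
      ∀ B (x : Var (ctx A Γ) B), bindNew A b B (ρ.lifts A B x) = 0 := by
  induction A with
  | o => intro Γ Δ ρ b h; exact h
  | arr A C _ ihC =>
    intro Γ Δ ρ b h
    refine ihC (ρ.lift A) _ fun B x => ?_
    cases x with
    | zero => rfl
    | succ x => exact h _ x

/-- This guarantees that the binder of a parameter is itself of strictly larger order, so that only
the nodes below it can spoil incremental binding. -/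
theorem ord_lt_of_var_ctx (A : Ty) : ∀ {Γ : List Ty} {K : ℕ}, A.ord ≤ K →
    (∀ B, Var Γ B → B.ord < K) → ∀ B, Var (ctx A Γ) B → B.ord < K := by
  induction A with
  | o => intro Γ K _ h; exact h
  | arr A C _ ihC =>
    intro Γ K hK h
    have hK' := max_le_iff.1 (show max (A.ord + 1) C.ord ≤ K from hK)
    refine ihC hK'.2 fun B x => ?_
    cases x with
    | zero => exact hK'.1
    | succ x => exact h _ x

theorem etaVars_incBound {Sg : Sig.{u, v}} (A : Ty) :
    ∀ {Γ : List Ty} {K : ℕ} (p : List ℕ) (b : ∀ B : Ty, Var Γ B → ℕ), A.ord ≤ K →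
      (etaVars Sg A Γ).IncBound (K :: p) (bindNew A b) := by
  induction A with
  | o => intros; simp only [etaVars, CArgs.IncBound]
  | arr A B ihA ihB =>
    intro Γ K p b hK
    have hK' := max_le_iff.1 (show max (A.ord + 1) B.ord ≤ K from hK)
    have hA : A.ord < K := hK'.1
    simp only [etaVars, CArgs.IncBound, CTree.IncBound, CBody.IncBound, Ty.lamOrder_args]
    refine ⟨⟨?_, ihA _ _ le_rfl⟩, ihB _ _ hK'.2⟩
    -- Both sides equal 1: the variable node lies under the root of its own eta-expansion, whose
    -- order `A.ord` is not strictly larger, and the next node, of order `K`, is the binder.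
    refine Eq.trans ?_ ((bindNew_weaken A _ _).trans
      (congrArg (· + 1) (bindNew_weaken B _ Var.zero))).symm
    simp [List.findIdx_cons, hA]

/-- A variable bound just above the lambda nodes of orders `l` is bound incrementally exactly when
none of these orders exceeds its own. -/
theorem findIdx_append_eq_length_iff {n K : ℕ} (h : n < K) (l p : List ℕ) :
    (l ++ K :: p).findIdx (fun k => decide (n < k)) = l.length ↔ ∀ m ∈ l, m ≤ n := by
  induction l with
  | nil => simp [List.findIdx_cons, h]
  | cons a l ih =>
    by_cases ha : n < a
    · simp [List.findIdx_cons, ha]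
    · simp [List.findIdx_cons, ha, ih, Nat.le_of_not_lt ha]

/-! ### Operand nesting in applicative terms -/

/-- No variable of `e` has order less than a member of `l` or than the order of an operand of `e`
that contains it, and every non-terminal of `e` satisfies `R`. -/
def App.Nested {Sg : Sig.{u, v}} {Γ : List Ty} (R : Sg.N → Prop) :
    {A : Ty} → App Sg Γ A → List ℕ → Prop
  | A, .var _, l => ∀ m ∈ l, m ≤ A.ord
  | _, .term _, _ => True
  | _, .nt F, _ => R F
  | _, .app (A := A) s t, l => s.Nested R l ∧ t.Nested R (A.ord :: l)

/-- The right-hand sides met in the first `k` unfoldings of `F` respect operand nesting. -/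
def HORS.NestedUpTo (G : HORS.{u, v}) : ℕ → G.N → Prop
  | 0, _ => True
  | k + 1, F => (G.rhs F).Nested (G.NestedUpTo k) []

/-- The trees of an applicative term are incrementally-bound when its operands nest, provided that
this holds for its non-terminals. -/
theorem HORS.incBound_of_nt (G : HORS.{u, v}) (k : ℕ)
    (hnt : ∀ {Γ : List Ty} (F : G.N) (K : ℕ) (p : List ℕ) {Δ : List Ty} (ρ : Ren Γ Δ)
      (b : ∀ B : Ty, Var Δ B → ℕ),
      ((G.ty F).ord ≤ K →
        ((((G.unfold)^[k] (.nt F)).under ρ).IncBound (K :: p) (bindNew (G.ty F) b) ↔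
          G.NestedUpTo k F)) ∧
      (∀ ts : CArgs G.toSig Δ (G.ty F),
        ((((G.unfold)^[k] (.nt F)).spine ρ ts).IncBound (K :: p) b ↔
          G.NestedUpTo k F ∧ ts.IncBound (K :: p) b)))
    {Γ : List Ty} {A : Ty} (e : App G.toSig Γ A) :
    ∀ (q : List ℕ) (l : List ℕ) (K : ℕ) (p : List ℕ), q = l ++ K :: p →
      (∀ B, Var Γ B → B.ord < K) → ∀ {Δ : List Ty} (ρ : Ren Γ Δ) (b : ∀ B : Ty, Var Δ B → ℕ),
      (∀ B (x : Var Γ B), b B (ρ B x) = l.length) →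
      (∀ K' p', q = K' :: p' → A.ord ≤ K' →
        ((((G.unfold)^[k] e.toTm).under ρ).IncBound q (bindNew A b) ↔
          e.Nested (G.NestedUpTo k) l)) ∧
      (∀ ts : CArgs G.toSig Δ A,
        ((((G.unfold)^[k] e.toTm).spine ρ ts).IncBound q b ↔
          e.Nested (G.NestedUpTo k) l ∧ ts.IncBound q b)) := by
  induction e with
  | @var A x =>
    -- All variables of `Γ` share the binder of order `K`, and `l` holds the orders of the operands
    -- entered below it, so the binder is at position `l.length`.
    intro q l K p hq hΓ Δ ρ b hb
    have hx : q.findIdx (fun k => decide (A.ord < k)) = b A (ρ A x) ↔ ∀ m ∈ l, m ≤ A.ord := by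
      rw [hb, hq]
      exact findIdx_append_eq_length_iff (hΓ _ x) l p
    rw [App.toTm, HORS.iterate_unfold_var]
    constructor
    · rintro K' p' rfl hK
      simp only [Tm.under, CBody.IncBound, App.Nested]
      rw [bindNew_weaken, hx]
      exact and_iff_left (etaVars_incBound _ _ _ hK)
    · intro ts
      simp only [Tm.spine, CBody.IncBound, App.Nested]
      rw [hx]
  | term f =>
    intro q l K p hq hΓ Δ ρ b hb
    rw [App.toTm, HORS.iterate_unfold_term]
    constructor
    · rintro K' p' rfl hK
      simp only [Tm.under, CBody.IncBound, App.Nested, iff_true]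
      exact etaVars_incBound _ _ _ hK
    · intro ts
      simp only [Tm.spine, CBody.IncBound, App.Nested, true_and]
  | nt F =>
    intro q l K p hq hΓ Δ ρ b hb
    rw [App.toTm]
    refine ⟨?_, ?_⟩
    · rintro K' p' rfl hK
      exact (hnt F K' p' ρ b).1 hK
    · intro ts
      cases q with
      | nil => simp at hq
      | cons K' p' => exact (hnt F K' p' ρ b).2 ts
  | @app A B s t ihs iht =>
    intro q l K p hq hΓ Δ ρ b hb
    rw [App.toTm, HORS.iterate_unfold_app]
    constructor
    · rintro K' p' rfl hK
      have hb' : ∀ C (x : Var _ C), bindNew B b C ((ρ C x).weaken B) = l.length := fun C x => by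
        rw [bindNew_weaken, hb]
      refine ((ihs _ l K p hq hΓ (fun C x => (ρ C x).weaken B) (bindNew B b) hb').2 _).trans ?_
      simp only [CArgs.IncBound, CTree.IncBound, App.Nested, Ty.lamOrder_args]
      refine and_congr_right fun _ => ?_
      -- The variables added by eta-expansion impose no condition, as they are bound by the nearest
      -- lambda node, of order `K'`. What remains is the operand `t`, whose root puts `A.ord` on the
      -- path.
      refine (and_iff_left (etaVars_incBound _ _ _ hK)).trans ?_
      exact (iht (A.ord :: K' :: p') (A.ord :: l) K p (by rw [hq]; rfl) hΓ _ _ (fun C x => by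
        rw [hb']; rfl)).1 _ _ rfl le_rfl
    · intro ts
      refine ((ihs _ l K p hq hΓ ρ b hb).2 _).trans ?_
      simp only [CArgs.IncBound, CTree.IncBound, App.Nested, Ty.lamOrder_args]
      rw [and_assoc]
      refine and_congr_right fun _ => and_congr_left fun _ => ?_
      exact (iht (A.ord :: q) (A.ord :: l) K p (by rw [hq]; rfl) hΓ ρ _ (fun C x => by
        rw [hb]; rfl)).1 _ _ rfl le_rfl

/-- The tree of a closed abstraction `λ z₁ … zₘ. M` is determined by its body in every position. -/
theorem Tm.incBound_closed_lams {Sg : Sig.{u, v}} {A : Ty} (M : Tm Sg (ctx A []) .o) (P : Prop)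
    (hM : ∀ (K : ℕ) (p : List ℕ), A.ord ≤ K → ∀ {Δ : List Ty} (ρ : Ren (ctx A []) Δ)
      (b : ∀ B : Ty, Var Δ B → ℕ), (∀ B (x : Var (ctx A []) B), b B (ρ B x) = 0) →
      (((M.under ρ).IncBound (K :: p) b ↔ P) ∧ ((M.spine ρ .nil).IncBound (K :: p) b ↔ P)))
    (K : ℕ) (p : List ℕ) {Δ : List Ty} (ρ : Ren [] Δ) (b : ∀ B : Ty, Var Δ B → ℕ) :
    (A.ord ≤ K → (((Tm.lams A M).under ρ).IncBound (K :: p) (bindNew A b) ↔ P)) ∧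
    (∀ ts : CArgs Sg Δ A, (((Tm.lams A M).spine ρ ts).IncBound (K :: p) b ↔
      P ∧ ts.IncBound (K :: p) b)) := by
  have under : ∀ (K : ℕ) (p : List ℕ) (b : ∀ B : Ty, Var Δ B → ℕ), A.ord ≤ K →
      (((Tm.lams A M).under ρ).IncBound (K :: p) (bindNew A b) ↔ P) := fun K p b hK => by
    rw [Tm.under_lams]
    exact (hM K p hK (ρ.lifts A) _ (bindNew_lifts A ρ b fun _ x => nomatch x)).1
  refine ⟨under K p b, fun ts => ?_⟩
  cases A with
  -- At ground type there is no abstraction, hence no `@` and no new lambda node: the body stands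
  -- directly below the surrounding nodes.
  | o =>
    cases ts
    simp only [CArgs.IncBound, and_true]
    exact (hM K p (Nat.zero_le _) ρ b fun _ x => nomatch x).2
  -- Here the operator child of `@` has its own lambda node, of order exactly that of the type, and
  -- it binds the parameters as in operand position.
  | arr A B =>
    simp only [Tm.lams, Tm.spine, CBody.IncBound, CTree.IncBound, Ty.lamOrder_args]
    exact and_congr_left fun _ => under _ _ _ le_rfl

theorem HORS.incBound_iterate_unfold_rhs (G : HORS.{u, v}) (k : ℕ) (F : G.N) (K : ℕ)
    (p : List ℕ) {Δ : List Ty} (ρ : Ren [] Δ) (b : ∀ B : Ty, Var Δ B → ℕ) :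
    ((G.ty F).ord ≤ K → (((Tm.lams (G.ty F) ((G.unfold)^[k] (G.rhs F).toTm)).under ρ).IncBound
      (K :: p) (bindNew (G.ty F) b) ↔ G.NestedUpTo (k + 1) F)) ∧
    (∀ ts : CArgs G.toSig Δ (G.ty F),
      (((Tm.lams (G.ty F) ((G.unfold)^[k] (G.rhs F).toTm)).spine ρ ts).IncBound (K :: p) b ↔
        G.NestedUpTo (k + 1) F ∧ ts.IncBound (K :: p) b)) := by
  induction k generalizing F K p Δ b with
  | zero =>
    refine Tm.incBound_closed_lams _ _ (fun K p hK Δ ρ b hb => ?_) K p ρ b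
    -- With no unfolding left, non-terminals are mere labels and impose no condition, in accordance
    -- with `NestedUpTo 0`.
    have h := G.incBound_of_nt 0 (fun {Γ} F K p {Δ} ρ b => ⟨fun hK => by
        simp only [Function.iterate_zero, id, Tm.under, CBody.IncBound, HORS.NestedUpTo, iff_true]
        exact etaVars_incBound _ _ _ hK, fun ts => by
        simp only [Function.iterate_zero, id, Tm.spine, CBody.IncBound, HORS.NestedUpTo,
          true_and]⟩) (G.rhs F) (K :: p) [] K p rfl
      (ord_lt_of_var_ctx _ hK fun _ x => nomatch x) ρ b hb
    exact ⟨h.1 _ _ rfl (Nat.zero_le _),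
      (h.2 .nil).trans (by simp only [CArgs.IncBound, and_true]; rfl)⟩
  | succ k ih =>
    refine Tm.incBound_closed_lams _ _ (fun K p hK Δ ρ b hb => ?_) K p ρ b
    have h := G.incBound_of_nt (k + 1) (fun {Γ} F K p {Δ} ρ b => by
        rw [HORS.iterate_unfold_nt]
        have hr := Tm.under_spine_rename (Tm.lams (G.ty F) ((G.unfold)^[k] (G.rhs F).toTm))
        have hF := ih F K p (fun B (x : Var [] B) => ρ B (nomatch x)) b
        exact ⟨fun hK => (iff_of_eq (congrArg (CBody.IncBound · (K :: p) _) (hr.1 _ ρ))).trans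
            (hF.1 hK),
          fun ts => (iff_of_eq (congrArg (CBody.IncBound · (K :: p) _) (hr.2 _ ρ ts))).trans
            (hF.2 ts)⟩)
      (G.rhs F) (K :: p) [] K p rfl
      (ord_lt_of_var_ctx _ hK fun _ x => nomatch x) ρ b hb
    exact ⟨h.1 _ _ rfl (Nat.zero_le _),
      (h.2 .nil).trans (by simp only [CArgs.IncBound, and_true]; rfl)⟩

theorem HORS.incrementallyBound_iff (G : HORS.{u, v}) :
    G.IncrementallyBound ↔ ∀ k, G.NestedUpTo k G.start := by
  -- The shift to `k + 1` arises because `Λ(S)` already exposes the right-hand side of `S` before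
  -- any unfolding.
  have h (k : ℕ) : ((G.unfold)^[k] (G.Lam G.start)).tree.IncrementallyBound ↔
      G.NestedUpTo (k + 1) G.start := by
    rw [HORS.Lam, HORS.iterate_unfold_lams]
    simp only [CTree.IncrementallyBound, Tm.tree, CTree.IncBound, Ty.lamOrder_args]
    exact (G.incBound_iterate_unfold_rhs k G.start _ [] _ _).1 le_rfl
  refine ⟨fun H k => ?_, fun H k => (h k).2 (H (k + 1))⟩
  cases k with
  | zero => trivial
  | succ k => exact (h k).1 (H k)

/-! ### Operand nesting and safety -/

section Nested

variable {Sg : Sig.{u, v}} {Γ : List Ty} {R : Sg.N → Prop}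

theorem App.Nested.le_ord {A C : Ty} {e : App Sg Γ A} {z : Var Γ C} (hz : App.Contains z e) :
    ∀ {l : List ℕ}, e.Nested R l → ∀ m ∈ l, m ≤ C.ord := by
  induction hz with
  | here => intro l h; exact h
  | left _ _ ih => intro l h; exact ih h.1
  | right _ _ ih => intro l h m hm; exact ih h.2 m (List.mem_cons_of_mem _ hm)

/-- Entering an operand records its order; with `App.Nested.le_ord` this bounds that order by the
order of every variable inside. -/
theorem App.Nested.operand {A C : Ty} {e : App Sg Γ A} {t : App Sg Γ C} (ht : t.Operand e) :
    ∀ {l : List ℕ}, e.Nested R l → ∃ l', t.Nested R (C.ord :: l') := by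
  induction ht with
  | here _ => intro l h; exact ⟨l, h.2⟩
  | left _ _ ih => intro l h; exact ih h.1
  | right _ _ ih => intro l h; exact ih h.2

theorem App.nested_of_operands (hR : ∀ F, R F) {A : Ty} (e : App Sg Γ A) :
    ∀ l : List ℕ, (∀ (D : Ty) (z : Var Γ D), App.Contains z e → ∀ m ∈ l, m ≤ D.ord) →
      (∀ (C : Ty) (t : App Sg Γ C) (D : Ty) (z : Var Γ D),
        t.Operand e → App.Contains z t → C.ord ≤ D.ord) → e.Nested R l := by
  induction e with
  | var x => intro l hl _; exact hl _ x .here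
  | term f => intros; trivial
  | nt F => intros; exact hR F
  | app s t ihs iht =>
    intro l hl ho
    refine ⟨ihs l (fun D z hz => hl D z (.left _ hz)) (fun C r D z hr => ho C r D z (.left _ hr)),
      iht _ (fun D z hz m hm => ?_) (fun C r D z hr => ho C r D z (.right _ hr))⟩
    rcases List.mem_cons.1 hm with rfl | hm
    · exact ho _ t D z (.here s) hz
    · exact hl D z (.right _ hz) m hm

/-- All non-terminals of `e` satisfy `P`. -/
def App.AllNt (P : Sg.N → Prop) : {A : Ty} → App Sg Γ A → Prop
  | _, .var _ => True
  | _, .term _ => True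
  | _, .nt F => P F
  | _, .app s t => s.AllNt P ∧ t.AllNt P

def Args.AllNt (P : Sg.N → Prop) : {A : Ty} → Args Sg Γ A → Prop
  | _, .nil => True
  | _, .cons t ts => t.AllNt P ∧ ts.AllNt P

theorem App.allNt_of_nested {P : Sg.N → Prop} {S : ℕ → Sg.N → Prop} (hP : ∀ F, (∀ k, S k F) → P F)
    {A : Ty} (e : App Sg Γ A) : ∀ l : List ℕ, (∀ k, e.Nested (S k) l) → e.AllNt P := by
  induction e with
  | var x => intros; trivial
  | term f => intros; trivial
  | nt F => intro l h; exact hP F h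
  | app s t ihs iht => intro l h; exact ⟨ihs l fun k => (h k).1, iht _ fun k => (h k).2⟩

theorem App.allNt_apps {P : Sg.N → Prop} {A : Ty} (ts : Args Sg Γ A) :
    ∀ s : App Sg Γ A, (s.apps ts).AllNt P → s.AllNt P ∧ ts.AllNt P := by
  induction ts with
  | nil => intro s h; exact ⟨h, trivial⟩
  | cons t ts ih =>
    intro s h
    obtain ⟨⟨hs, ht⟩, hts⟩ := ih _ h
    exact ⟨hs, ht, hts⟩

theorem App.allNt_subst {P : Sg.N → Prop} {Δ : List Ty} (σ : Sub Sg Γ Δ)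
    (hσ : ∀ A x, (σ A x).AllNt P) {A : Ty} (e : App Sg Γ A) (he : e.AllNt P) :
    (e.subst σ).AllNt P := by
  induction e with
  | var x => exact hσ _ x
  | term f => trivial
  | nt F => exact he
  | app s t ihs iht => exact ⟨ihs he.1, iht he.2⟩

theorem Args.allNt_sub {P : Sg.N → Prop} {A : Ty} (ts : Args Sg Γ A) (hts : ts.AllNt P) :
    ∀ {Θ : List Ty} (σ : Sub Sg Θ Γ), (∀ B x, (σ B x).AllNt P) →
      ∀ B x, (ts.sub σ B x).AllNt P := by
  induction ts with
  | nil => intro Θ σ h; exact h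
  | cons t ts ih =>
    intro Θ σ h
    refine ih hts.2 _ fun B x => ?_
    cases x with
    | zero => exact hts.1
    | succ x => exact h _ x

end Nested

-- Invariants along derivations, and the two implications

/-- The non-terminals of the new term come from the old term or from the right-hand side of the rule
used, whose head occurs in the old term. -/
theorem HORS.StepBy.allNt {G : HORS.{u, v}} {P : G.N → Prop}
    (hP : ∀ F, P F → (G.rhs F).AllNt P) {F : G.N} {A : Ty} {s s' : App G.toSig [] A}
    (h : G.StepBy F s s') : s.AllNt P → P F ∧ s'.AllNt P := by
  induction h with
  | rule ts =>
    intro hs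
    obtain ⟨hF, hts⟩ := App.allNt_apps ts _ hs
    exact ⟨hF, App.allNt_subst _ (ts.allNt_sub hts _ fun B (x : Var [] B) => nomatch x) _ (hP F hF)⟩
  | left t _ ih => intro hs; exact ⟨(ih hs.1).1, (ih hs.1).2, hs.2⟩
  | right s _ ih => intro hs; exact ⟨(ih hs.2).1, hs.1, (ih hs.2).2⟩

/-- Without dead rules, a property of the start symbol that is passed on to the non-terminals of
right-hand sides holds for all non-terminals. -/
theorem HORS.NoDeadRule.forall_nt {G : HORS.{u, v}} (hG : G.NoDeadRule) {P : G.N → Prop}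
    (hS : P G.start) (hP : ∀ F, P F → (G.rhs F).AllNt P) (F : G.N) : P F := by
  obtain ⟨t, t', hst, htt'⟩ := hG F
  have ht : t.AllNt P := by
    clear htt'
    induction hst with
    | refl => exact hS
    | tail _ h ih =>
      obtain ⟨F', hF'⟩ := h
      exact (hF'.allNt hP ih).2
  exact (htt'.allNt hP ht).1

theorem HORS.nestedUpTo_of_not_hasUnsafeRule {G : HORS.{u, v}} (h : ¬ G.HasUnsafeRule) (k : ℕ) :
    ∀ F, G.NestedUpTo k F := by
  induction k with
  | zero => intro F; trivial
  | succ k ih =>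
    intro F
    refine App.nested_of_operands ih _ [] (by simp) fun C t D z ht hz => ?_
    by_contra hlt
    exact h ⟨F, C, t, D, z, ht, hz, not_le.1 hlt⟩

theorem HORS.NoDeadRule.not_hasUnsafeRule {G : HORS.{u, v}} (hG : G.NoDeadRule)
    (h : ∀ k, G.NestedUpTo k G.start) : ¬ G.HasUnsafeRule := by
  rintro ⟨F, C, t, D, z, ht, hz, hlt⟩
  have hF : ∀ k, G.NestedUpTo k F :=
    hG.forall_nt (P := fun F => ∀ k, G.NestedUpTo k F) h
      -- Nesting of `F` to depth `k + 1` demands depth `k` of the non-terminals in its right-hand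
      -- side, so nesting to all depths is inherited.
      (fun F hF => App.allNt_of_nested (fun _ => id) _ [] fun k => hF (k + 1)) F
  -- Depth 1 speaks of the right-hand side of `F` alone, which is where the unsafe operand sits.
  obtain ⟨l, hl⟩ := App.Nested.operand ht (hF 1)
  exact absurd (App.Nested.le_ord hz hl _ List.mem_cons_self) (not_le.2 hlt)

end RecScheme

theorem mainTheorem5 (G : RecScheme.HORS.{u, v}) (hG : G.NoDeadRule) :
    G.Safe ↔ G.Homogeneous ∧ G.IncrementallyBound := by
  rw [RecScheme.HORS.Safe, G.incrementallyBound_iff]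
  exact and_congr_right fun _ =>
    ⟨fun h k => RecScheme.HORS.nestedUpTo_of_not_hasUnsafeRule h k _, hG.not_hasUnsafeRule⟩
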